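/- Let $k>1$ be an odd positive integer. Let $\psi=\Gamma'/\Gamma$ be the digamma function, $\gamma$ Euler's constant, $\zeta$ the Riemann zeta function, $\mathrm{Li}_k(t)=\sum_{n=1}^\infty \frac{t^n}{n^k}$ for $|t|<1$, and $F_k(x)=\sum_{n=1}^\infty \frac{\psi(nx)}{n^k}$ for $x\in\mathbb{C}\setminus(-\infty,0]$. Then the series defining $F_k(2)$ and the integral below converge absolutely, and $$\int_0^1\left(\frac{2^{k-1}}{u-1}-\frac{2u}{u^2-1}-\frac{2^{k-1}-1}{u\log u}\right)\mathrm{Li}_k(-u)\,du$$ $$=\left(1-2^{1-k}\right)F_k(2)+(2^{k-1}-1)\gamma\zeta(k)+\left(\frac12-2^{-k}\right)\zeta(k+1)+\left(2-2^{k-1}-2^{1-k}\right)\zeta'(k)$$ $$\quad+\sum_{r=2}^{k-1}(-1)^{r-1}\left(2^{k-2}+2^{-k}-2^{r-k}\right)\zeta(r)\zeta(k+1-r).$$ -/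

import Mathlib

noncomputable section

/-- The polylogarithm `Li_s(t) = ∑_{n ≥ 1} t ^ n / n ^ s`, given by its power series on the disc
`‖t‖ < 1`. The summation index is shifted by one. -/
def polylog (s t : ℂ) : ℂ :=
  ∑' n : ℕ, t ^ (n + 1) / ((n + 1 : ℕ) : ℂ) ^ s

/-- The term of index `n + 1` of the series `∑_{n ≥ 1} ψ(n x) / n ^ k`, where
`ψ = Γ' / Γ` is the digamma function. -/
def higherHerglotzTerm (k : ℕ) (x : ℂ) (n : ℕ) : ℂ :=
  Complex.digamma (((n + 1 : ℕ) : ℂ) * x) / ((n + 1 : ℕ) : ℂ) ^ k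

/-- The higher Herglotz function `F_k(x) = ∑_{n ≥ 1} ψ(n x) / n ^ k`
(for `k > 1` and `x` off the half-line `(-∞, 0]`). -/
def higherHerglotz (k : ℕ) (x : ℂ) : ℂ :=
  ∑' n : ℕ, higherHerglotzTerm k x n

/-- The integrand
`(2^(k-1)/(u-1) - 2u/(u^2-1) - (2^(k-1)-1)/(u log u)) Li_k(-u)` for real `u`. -/
def polylogIntegrand (k : ℕ) (u : ℝ) : ℂ :=
  (((2 : ℂ) ^ ((k : ℤ) - 1)) / ((u : ℂ) - 1) - 2 * (u : ℂ) / ((u : ℂ) ^ 2 - 1)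
    - ((2 : ℂ) ^ ((k : ℤ) - 1) - 1) / ((u : ℂ) * (Real.log u : ℂ))) * polylog (k : ℂ) (-(u : ℂ))

end

/-! Put A = 2^(k-1) - 1 and g(u) = u/(u-1) - 1/log u. Since 2u/(u²-1) = 1/(u-1) + 1/(u+1), the
kernel of the integrand is (A g(u) - u/(1+u))/u, with bounded numerator on (0,1), so Li_k(-u) may be
integrated termwise. By `integral_pow_mul_gaussKernel` this leaves alternating sums over n^k of H_n
- γ - log n and of ∫ u^n/(1+u).

An alternating sum is twice its even part minus the full sum. The even part of ∑ H_n/n^k gives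
F_k(2), because ψ(2n) = H_(2n) - 1/(2n) - γ; the logarithms give ζ'(k) and a multiple of log 2 ζ(k).
The full sum ∑ H_n/n^k and the sum of the integrals ∫ u^n/(1+u) are Tornheim series with e = 1 and e
= -1, the latter up to a log 2 term that cancels the former one.

For odd k, `tornheim_one_of_odd` evaluates both Tornheim series as sums of products of (twisted)
zeta values; those with e = -1 reduce to ordinary ones by `sum_twistedZeta_neg_one`. -/

/-! ### Tornheim series and their reduction for odd weight parameter -/

/-- The term `e ^ (m + n) / (m ^ a n ^ b (m + n))` of the Tornheim double series, with both indices
shifted by one. -/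
noncomputable def tornheimTerm (e : ℝ) (a b : ℕ) (p : ℕ × ℕ) : ℝ :=
  e ^ (p.1 + 1) * e ^ (p.2 + 1) /
    (((p.1 + 1 : ℕ) : ℝ) ^ a * ((p.2 + 1 : ℕ) : ℝ) ^ b * ((p.1 + 1 : ℕ) + (p.2 + 1 : ℕ) : ℝ))

/-- The Tornheim double series `∑ e ^ (m + n) / (m ^ a n ^ b (m + n))`. -/
noncomputable def tornheim (e : ℝ) (a b : ℕ) : ℝ := ∑' p : ℕ × ℕ, tornheimTerm e a b p

/-- The series `∑ e ^ n / n ^ r` over `n ≥ 1`. -/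
noncomputable def twistedZeta (e : ℝ) (r : ℕ) : ℝ := ∑' n : ℕ, e ^ (n + 1) / ((n + 1 : ℕ) : ℝ) ^ r

lemma norm_pow_le_one {e : ℝ} (he : |e| ≤ 1) (n : ℕ) : ‖e ^ n‖ ≤ 1 := by
  rw [norm_pow, Real.norm_eq_abs]
  exact pow_le_one₀ (abs_nonneg e) he

lemma summable_one_div_succ_pow {r : ℕ} (hr : 2 ≤ r) :
    Summable fun n : ℕ => 1 / ((n + 1 : ℕ) : ℝ) ^ r :=
  (summable_nat_add_iff 1).2 (Real.summable_one_div_nat_pow.2 hr)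

lemma summable_mul_of_bounded {c f : ℕ → ℝ} (C : ℝ) (hc : ∀ n, ‖c n‖ ≤ C) (hf : Summable f)
    (hf0 : ∀ n, 0 ≤ f n) : Summable fun n => c n * f n := by
  refine Summable.of_norm_bounded (hf.mul_left C) fun n => ?_
  rw [norm_mul, Real.norm_of_nonneg (hf0 n)]
  exact mul_le_mul_of_nonneg_right (hc n) (hf0 n)

lemma summable_twistedZeta {e : ℝ} (he : |e| ≤ 1) {r : ℕ} (hr : 2 ≤ r) :
    Summable fun n : ℕ => e ^ (n + 1) / ((n + 1 : ℕ) : ℝ) ^ r := by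
  have := summable_mul_of_bounded (c := fun n => e ^ (n + 1)) 1 (fun n => norm_pow_le_one he _)
    (summable_one_div_succ_pow hr) (fun n => by positivity)
  simpa only [mul_one_div] using this

lemma summable_tornheimTerm {e : ℝ} (he : |e| ≤ 1) {a b : ℕ} (ha : 1 ≤ a) (hb : 1 ≤ b) :
    Summable (tornheimTerm e a b) := by
  -- √x √y ≤ x + y shares the factor 1/(x + y) between the two indices: each gains half a power,
  -- hence the exponent 3/2.
  have h0 : Summable fun n : ℕ => 1 / ((n + 1 : ℕ) : ℝ) ^ (3 / 2 : ℝ) :=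
    (summable_nat_add_iff 1).2 (Real.summable_one_div_nat_rpow.2 (by norm_num))
  refine Summable.of_norm_bounded
    (h0.mul_of_nonneg h0 (fun n => by positivity) (fun n => by positivity)) fun p => ?_
  obtain ⟨m, n⟩ := p
  simp only [tornheimTerm]
  set x : ℝ := ((m + 1 : ℕ) : ℝ) with hx
  set y : ℝ := ((n + 1 : ℕ) : ℝ) with hy
  have hx1 : 1 ≤ x := by simp [hx]
  have hy1 : 1 ≤ y := by simp [hy]
  have hx0 : 0 < x := by linarith
  have hy0 : 0 < y := by linarith
  rw [norm_div, norm_mul, one_div_mul_one_div,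
    Real.norm_of_nonneg (r := x ^ a * y ^ b * (x + y)) (by positivity)]
  have h1 : ‖e ^ (m + 1)‖ * ‖e ^ (n + 1)‖ ≤ 1 :=
    mul_le_one₀ (norm_pow_le_one he _) (norm_nonneg _) (norm_pow_le_one he _)
  refine div_le_div₀ zero_le_one h1 (by positivity) ?_
  have hsx : x ^ (3 / 2 : ℝ) = x * √x := by
    rw [show (3 / 2 : ℝ) = 1 + 1 / 2 by norm_num, Real.rpow_add hx0, Real.rpow_one,
      Real.sqrt_eq_rpow]
  have hsy : y ^ (3 / 2 : ℝ) = y * √y := by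
    rw [show (3 / 2 : ℝ) = 1 + 1 / 2 by norm_num, Real.rpow_add hy0, Real.rpow_one,
      Real.sqrt_eq_rpow]
  rw [hsx, hsy]
  have hxa : x ≤ x ^ a := le_self_pow₀ hx1 (by omega)
  have hyb : y ≤ y ^ b := le_self_pow₀ hy1 (by omega)
  have hs : √x * √y ≤ x + y := by
    nlinarith [Real.sq_sqrt hx0.le, Real.sq_sqrt hy0.le, sq_nonneg (√x - √y),
      Real.sqrt_nonneg x, Real.sqrt_nonneg y]
  calc x * √x * (y * √y) = x * y * (√x * √y) := by ring
    _ ≤ x ^ a * y ^ b * (x + y) := by gcongr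

lemma tornheim_comm (e : ℝ) (a b : ℕ) : tornheim e a b = tornheim e b a := by
  unfold tornheim
  rw [← (Equiv.prodComm ℕ ℕ).tsum_eq]
  refine tsum_congr fun p => ?_
  simp only [tornheimTerm, Equiv.prodComm_apply, Prod.fst_swap, Prod.snd_swap]
  ring_nf

/-- Partial fractions: (1/m + 1/n)/(m + n) = 1/(m n), so the double sum factors. -/
lemma tornheim_add_tornheim {e : ℝ} (he : |e| ≤ 1) {a b : ℕ} (ha : 1 ≤ a) (hb : 1 ≤ b) :
    tornheim e a (b + 1) + tornheim e (a + 1) b = twistedZeta e (a + 1) * twistedZeta e (b + 1) := by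
  unfold tornheim twistedZeta
  rw [← (summable_tornheimTerm he ha (by omega)).tsum_add
    (summable_tornheimTerm he (by omega) hb),
    tsum_mul_tsum_of_summable_norm (summable_twistedZeta he (by omega)).norm
      (summable_twistedZeta he (by omega)).norm]
  refine tsum_congr fun p => ?_
  simp only [tornheimTerm]
  have h1 : ((p.1 + 1 : ℕ) : ℝ) ≠ 0 := by positivity
  have h2 : ((p.2 + 1 : ℕ) : ℝ) ≠ 0 := by positivity
  have h3 : ((p.1 + 1 : ℕ) + (p.2 + 1 : ℕ) : ℝ) ≠ 0 := by positivity
  generalize ((p.1 + 1 : ℕ) : ℝ) = x at *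
  generalize ((p.2 + 1 : ℕ) : ℝ) = y at *
  field_simp
  ring

/-- Iterates `tornheim_add_tornheim`: each of the j steps moves one power from n to m and flips the
sign of the remaining series. -/
lemma tornheim_one_eq_sum {e : ℝ} (he : |e| ≤ 1) {k : ℕ} (j : ℕ) (hj : j + 2 ≤ k) :
    tornheim e 1 (k - 1) =
      ∑ r ∈ Finset.Icc 2 (j + 1), (-1 : ℝ) ^ r * twistedZeta e r * twistedZeta e (k + 1 - r)
        + (-1) ^ j * tornheim e (j + 1) (k - 1 - j) := by
  induction j with
  | zero => simp
  | succ j ih =>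
    rw [ih (by omega), Finset.sum_Icc_succ_top (b := j + 1) (by omega)]
    have h := tornheim_add_tornheim he (a := j + 1) (b := k - 1 - (j + 1)) (by omega) (by omega)
    rw [show k - 1 - (j + 1) + 1 = k - 1 - j by omega] at h
    rw [show k + 1 - (j + 1 + 1) = k - 1 - j by omega, eq_sub_of_add_eq h]
    ring

/-- For odd `k`, Euler's reflection evaluates the Tornheim series `∑ e ^ (m + n) / (m n ^ (k - 1) (m + n))`. -/
lemma tornheim_one_of_odd {e : ℝ} (he : |e| ≤ 1) {k : ℕ} (hk : 1 < k) (hodd : Odd k) :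
    2 * tornheim e 1 (k - 1) =
      ∑ r ∈ Finset.Icc 2 (k - 1), (-1 : ℝ) ^ r * twistedZeta e r * twistedZeta e (k + 1 - r) := by
  have h := tornheim_one_eq_sum he (k := k) (k - 2) (by omega)
  -- After k - 2 steps the exponents (1, k - 1) have become (k - 1, 1). This is the same series by
  -- symmetry, and the odd number of sign changes lets it be solved for.
  have ho : Odd (k - 2) := by
    obtain ⟨m, rfl⟩ := hodd
    exact ⟨m - 1, by omega⟩
  rw [ho.neg_one_pow, show k - 2 + 1 = k - 1 by omega, show k - 1 - (k - 2) = 1 by omega,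
    tornheim_comm e (k - 1) 1] at h
  linarith

/-! ### Integral form of the Tornheim series -/

lemma one_div_sub_one_div_nonneg (m n : ℕ) : 0 ≤ 1 / (m + 1 : ℝ) - 1 / (m + 1 + n : ℝ) :=
  sub_nonneg.2 (one_div_le_one_div_of_le (by positivity) (le_add_of_nonneg_right n.cast_nonneg))

lemma summable_one_div_sub_one_div (n : ℕ) :
    Summable fun m : ℕ => 1 / (m + 1 : ℝ) - 1 / (m + 1 + n : ℝ) := by
  refine Summable.of_nonneg_of_le (one_div_sub_one_div_nonneg · n) (fun m => ?_)
    ((summable_one_div_succ_pow le_rfl).mul_left (n : ℝ))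
  · rw [div_sub_div _ _ (by positivity) (by positivity), mul_one_div]
    push_cast
    rw [show (1 * (m + 1 + n) - (m + 1) * 1 : ℝ) = n by ring]
    rw [sq]
    exact div_le_div_of_nonneg_left n.cast_nonneg (by positivity)
      (mul_le_mul_of_nonneg_left (le_add_of_nonneg_right n.cast_nonneg) (by positivity))

/-- The difference is ∫ (u^m - u^(m+n)), and the geometric series is summed under the integral.
Keeping the two fractions together makes the sum absolutely convergent even for e = 1. -/
lemma tsum_pow_mul_sub_eq_integral {e : ℝ} (he : |e| ≤ 1) (n : ℕ) :
    ∑' m : ℕ, e ^ m * (1 / (m + 1 : ℝ) - 1 / (m + 1 + n : ℝ)) =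
      ∫ u in (0 : ℝ)..1, (1 - u ^ n) / (1 - e * u) := by
  have hint (m : ℕ) : ∫ u in (0 : ℝ)..1, (u ^ m - u ^ (m + n)) =
      1 / (m + 1 : ℝ) - 1 / (m + 1 + n : ℝ) := by
    rw [intervalIntegral.integral_sub (by simp) (by simp), integral_pow, integral_pow]
    push_cast
    simp [add_right_comm]
  have hi (m : ℕ) : MeasureTheory.Integrable (fun u : ℝ => e ^ m * (u ^ m - u ^ (m + n)))
      (MeasureTheory.volume.restrict (Set.Ioc 0 1)) :=
    (intervalIntegrable_iff_integrableOn_Ioc_of_le zero_le_one).1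
      (Continuous.intervalIntegrable (by fun_prop) 0 1)
  have hn (m : ℕ) : ∫ u in Set.Ioc (0 : ℝ) 1, ‖e ^ m * (u ^ m - u ^ (m + n))‖ =
      |e ^ m| * (1 / (m + 1 : ℝ) - 1 / (m + 1 + n : ℝ)) := by
    rw [← hint m, intervalIntegral.integral_of_le zero_le_one, ← MeasureTheory.integral_const_mul]
    refine MeasureTheory.setIntegral_congr_fun measurableSet_Ioc fun u hu => ?_
    simp only [norm_mul, Real.norm_eq_abs]
    rw [abs_of_nonneg (a := u ^ m - u ^ (m + n))]
    exact sub_nonneg.2 (pow_le_pow_of_le_one hu.1.le hu.2 (by omega))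
  have hs : Summable fun m : ℕ => ∫ u in Set.Ioc (0 : ℝ) 1, ‖e ^ m * (u ^ m - u ^ (m + n))‖ := by
    simp_rw [hn]
    refine summable_mul_of_bounded 1 (fun m => ?_) (summable_one_div_sub_one_div n)
      (one_div_sub_one_div_nonneg · n)
    simpa using norm_pow_le_one he m
  have key := (MeasureTheory.hasSum_integral_of_summable_integral_norm hi hs).tsum_eq
  rw [intervalIntegral.integral_of_le zero_le_one]
  calc _ = ∑' m : ℕ, ∫ u in Set.Ioc (0 : ℝ) 1, e ^ m * (u ^ m - u ^ (m + n)) := by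
        refine tsum_congr fun m => ?_
        rw [MeasureTheory.integral_const_mul, ← hint m,
          intervalIntegral.integral_of_le zero_le_one]
    _ = _ := by
        rw [key, MeasureTheory.integral_Ioc_eq_integral_Ioo,
          MeasureTheory.integral_Ioc_eq_integral_Ioo]
        refine MeasureTheory.setIntegral_congr_fun measurableSet_Ioo fun u hu => ?_
        have hu' : |e * u| < 1 := by
          rw [abs_mul, abs_of_pos hu.1]
          nlinarith [hu.1, hu.2, abs_nonneg e]
        calc ∑' m : ℕ, e ^ m * (u ^ m - u ^ (m + n)) = ∑' m : ℕ, (1 - u ^ n) * (e * u) ^ m :=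
              tsum_congr fun m => by rw [mul_pow, pow_add]; ring
          _ = _ := by rw [tsum_mul_left, tsum_geometric_of_abs_lt_one hu', div_eq_mul_inv]

/-- Sums over the index of exponent 1 first; 1/(m(m+n)) = (1/m - 1/(m+n))/n accounts for the
exponent b + 1. -/
lemma tornheim_one_eq_tsum {e : ℝ} (he : |e| ≤ 1) {b : ℕ} (hb : 1 ≤ b) :
    tornheim e 1 b = ∑' n : ℕ, e * e ^ (n + 1) *
      (∫ u in (0 : ℝ)..1, (1 - u ^ (n + 1)) / (1 - e * u)) / ((n + 1 : ℕ) : ℝ) ^ (b + 1) := by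
  rw [tornheim_comm, tornheim, (summable_tornheimTerm he hb le_rfl).tsum_prod]
  refine tsum_congr fun n => ?_
  rw [← tsum_pow_mul_sub_eq_integral he, ← tsum_mul_left, ← tsum_div_const]
  refine tsum_congr fun m => ?_
  simp only [tornheimTerm]
  push_cast
  have h1 : (m + 1 : ℝ) ≠ 0 := by positivity
  have h2 : (n + 1 : ℝ) ≠ 0 := by positivity
  have h3 : (n + 1 + (m + 1) : ℝ) ≠ 0 := by positivity
  have h4 : (m + 1 + (n + 1) : ℝ) ≠ 0 := by positivity
  field_simp
  ring

/-! ### Termwise integration and the bounded logarithmic kernel -/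

open MeasureTheory in
/-- Termwise integration on `(0, 1]` of a power series with summable coefficients against a bounded
kernel. -/
lemma integrable_and_hasSum_integral_tsum_mul {c : ℕ → ℝ} (hc : Summable fun n => ‖c n‖)
    {K : ℝ → ℝ} (hK : Measurable K) {C : ℝ} (hC : ∀ u ∈ Set.Ioo (0 : ℝ) 1, ‖K u‖ ≤ C) :
    IntervalIntegrable (fun u => ∑' n, c n * (u ^ n * K u)) volume 0 1 ∧
    HasSum (fun n => c n * ∫ u in (0 : ℝ)..1, u ^ n * K u)
      (∫ u in (0 : ℝ)..1, ∑' n, c n * (u ^ n * K u)) := by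
  have hae : ∀ᵐ u ∂volume.restrict (Set.Ioc (0 : ℝ) 1), ∀ n : ℕ,
      ‖c n * (u ^ n * K u)‖ ≤ ‖c n‖ * C := by
    rw [← restrict_Ioo_eq_restrict_Ioc]
    refine (ae_restrict_iff' measurableSet_Ioo).2 (Filter.Eventually.of_forall fun u hu n => ?_)
    rw [norm_mul, norm_mul]
    refine mul_le_mul_of_nonneg_left ?_ (norm_nonneg _)
    have h1 : ‖u ^ n‖ ≤ 1 := norm_pow_le_one (by rw [abs_of_pos hu.1]; exact hu.2.le) n
    calc ‖u ^ n‖ * ‖K u‖ ≤ 1 * C := mul_le_mul h1 (hC u hu) (norm_nonneg _) zero_le_one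
      _ = C := one_mul C
  have hm (n : ℕ) : Measurable fun u => c n * (u ^ n * K u) := by fun_prop
  have hi (n : ℕ) : Integrable (fun u => c n * (u ^ n * K u))
      (volume.restrict (Set.Ioc (0 : ℝ) 1)) :=
    Integrable.mono' (integrable_const (‖c n‖ * C)) (hm n).aestronglyMeasurable
      (hae.mono fun u hu => hu n)
  have hsum : Summable fun n => ∫ u in Set.Ioc (0 : ℝ) 1, ‖c n * (u ^ n * K u)‖ := by
    refine Summable.of_nonneg_of_le (fun n => integral_nonneg fun u => norm_nonneg _) (fun n => ?_)
      (hc.mul_right C)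
    calc _ ≤ ∫ u in Set.Ioc (0 : ℝ) 1, ‖c n‖ * C :=
          integral_mono_ae (hi n).norm (integrable_const _) (hae.mono fun u hu => hu n)
      _ = _ := by simp
  constructor
  · rw [intervalIntegrable_iff_integrableOn_Ioc_of_le zero_le_one]
    refine Integrable.mono' (integrable_const (∑' n, ‖c n‖ * C)) ?_ (hae.mono fun u hu => ?_)
    · exact (Measurable.tsum hm).aestronglyMeasurable
    · exact tsum_of_norm_bounded (hc.mul_right C).hasSum hu
  · have := hasSum_integral_of_summable_integral_norm hi hsum
    simp only [intervalIntegral.integral_of_le zero_le_one, ← integral_const_mul]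
    exact this

/-- The kernel `u / (u - 1) - 1 / log u`, which is bounded on `(0, 1)`. -/
noncomputable def gaussKernel (u : ℝ) : ℝ := u / (u - 1) - 1 / Real.log u

lemma measurable_gaussKernel : Measurable gaussKernel := by
  unfold gaussKernel
  fun_prop

/-- The lower bound is 1 - 1/u ≤ log u and the upper bound is log u ≤ u - 1, over the common
denominator (1 - u)(-log u). -/
lemma gaussKernel_mem_Icc {u : ℝ} (hu : u ∈ Set.Ioo (0 : ℝ) 1) :
    gaussKernel u ∈ Set.Icc (0 : ℝ) 1 := by
  have h1 : Real.log u < 0 := Real.log_neg hu.1 hu.2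
  have h2 : Real.log u ≤ u - 1 := Real.log_le_sub_one_of_pos hu.1
  have h3 : 1 - u⁻¹ ≤ Real.log u := Real.one_sub_inv_le_log_of_pos hu.1
  have h4 : u - 1 ≤ u * Real.log u := by
    have := mul_le_mul_of_nonneg_left h3 hu.1.le
    rwa [mul_sub, mul_inv_cancel₀ hu.1.ne', mul_one] at this
  have h5 : 0 < (1 - u) * (-Real.log u) := mul_pos (by linarith [hu.2]) (by linarith)
  have h6 : gaussKernel u = (u * Real.log u - (u - 1)) / ((1 - u) * (-Real.log u)) := by
    have : u - 1 ≠ 0 := by linarith [hu.2]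
    have : 1 - u ≠ 0 := by linarith [hu.2]
    have := h1.ne
    unfold gaussKernel
    field_simp
    ring
  rw [h6]
  refine ⟨div_nonneg (by linarith) h5.le, (div_le_one h5).2 ?_⟩
  nlinarith

lemma norm_gaussKernel_le {u : ℝ} (hu : u ∈ Set.Ioo (0 : ℝ) 1) : ‖gaussKernel u‖ ≤ 1 := by
  rw [Real.norm_of_nonneg (gaussKernel_mem_Icc hu).1]
  exact (gaussKernel_mem_Icc hu).2

lemma intervalIntegrable_of_bounded_Ioo {K : ℝ → ℝ} (hK : Measurable K) {C : ℝ}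
    (hC : ∀ u ∈ Set.Ioo (0 : ℝ) 1, ‖K u‖ ≤ C) :
    IntervalIntegrable K MeasureTheory.volume 0 1 := by
  rw [intervalIntegrable_iff_integrableOn_Ioo_of_le zero_le_one]
  exact MeasureTheory.Integrable.mono' (MeasureTheory.integrable_const C) hK.aestronglyMeasurable
    ((MeasureTheory.ae_restrict_iff' measurableSet_Ioo).2 (Filter.Eventually.of_forall hC))

lemma intervalIntegrable_pow_mul_of_bounded {K : ℝ → ℝ} (hK : Measurable K) {C : ℝ}
    (hC : ∀ u ∈ Set.Ioo (0 : ℝ) 1, ‖K u‖ ≤ C) (n : ℕ) :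
    IntervalIntegrable (fun u => u ^ n * K u) MeasureTheory.volume 0 1 :=
  (intervalIntegrable_of_bounded_Ioo hK hC).continuousOn_mul (by fun_prop)

lemma intervalIntegral_congr_Ioo {f g : ℝ → ℝ} (h : ∀ u ∈ Set.Ioo (0 : ℝ) 1, f u = g u) :
    ∫ u in (0 : ℝ)..1, f u = ∫ u in (0 : ℝ)..1, g u := by
  simp only [intervalIntegral.integral_of_le zero_le_one,
    MeasureTheory.integral_Ioc_eq_integral_Ioo]
  exact MeasureTheory.setIntegral_congr_fun measurableSet_Ioo h

/-- Frullani's integral `∫₀¹ (u ^ (n + 1) - u ^ n) / log u = log ((n + 2) / (n + 1))`. -/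
lemma integral_pow_sub_pow_div_log (n : ℕ) :
    ∫ u in (0 : ℝ)..1, (u ^ (n + 1) - u ^ n) / Real.log u =
      Real.log (n + 2) - Real.log (n + 1) := by
  have hn : (n : ℝ) ≤ n + 1 := by linarith
  -- The quotient is the integral of u^s over s from n to n + 1; Fubini then leaves ∫ ds/(s + 1).
  have h1 : ∫ u in (0 : ℝ)..1, (u ^ (n + 1) - u ^ n) / Real.log u =
      ∫ u in (0 : ℝ)..1, ∫ s in (n : ℝ)..(n + 1), u ^ s := by
    refine intervalIntegral_congr_Ioo fun u hu => ?_
    have hl : Real.log u ≠ 0 := (Real.log_neg hu.1 hu.2).ne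
    have hd (s : ℝ) : HasDerivAt (fun s : ℝ => u ^ s / Real.log u) (u ^ s) s := by
      have := (Real.hasStrictDerivAt_const_rpow hu.1 s).hasDerivAt.div_const (Real.log u)
      rwa [mul_div_cancel_right₀ _ hl] at this
    rw [intervalIntegral.integral_eq_sub_of_hasDerivAt (fun s _ => hd s)
      (Continuous.intervalIntegrable (Real.continuous_const_rpow hu.1.ne') _ _), ← sub_div, Real.rpow_natCast]
    rw [← Real.rpow_natCast u (n + 1)]
    push_cast
    rfl
  rw [h1, MeasureTheory.intervalIntegral_intervalIntegral_swap]
  · have h2 : ∀ s ∈ Set.uIcc (n : ℝ) (n + 1), ∫ u in (0 : ℝ)..1, u ^ s = (s + 1)⁻¹ := by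
      intro s hs
      rw [Set.uIcc_of_le hn] at hs
      have hs0 : 0 ≤ s := le_trans n.cast_nonneg hs.1
      rw [integral_rpow (Or.inl (by linarith)), Real.one_rpow, Real.zero_rpow (by linarith)]
      simp
    rw [intervalIntegral.integral_congr h2,
      intervalIntegral.integral_comp_add_right (fun s => s⁻¹) 1,
      integral_inv_of_pos (by positivity) (by positivity), Real.log_div (by positivity)
      (by positivity)]
    ring_nf
  · rw [Set.uIoc_of_le zero_le_one, Set.uIoc_of_le hn]
    refine MeasureTheory.Measure.integrableOn_of_bounded (M := 1) ?_ ?_ ?_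
    · rw [MeasureTheory.Measure.volume_eq_prod, MeasureTheory.Measure.prod_prod]
      simp
    · exact Measurable.aestronglyMeasurable (by unfold Function.uncurry; fun_prop)
    · refine (MeasureTheory.ae_restrict_iff' (measurableSet_Ioc.prod measurableSet_Ioc)).2
        (Filter.Eventually.of_forall fun p hp => ?_)
      obtain ⟨⟨h1, h2⟩, h3, h4⟩ := hp
      rw [Function.uncurry, Real.norm_of_nonneg (Real.rpow_nonneg h1.le _)]
      exact Real.rpow_le_one h1.le h2 (le_trans n.cast_nonneg h3.le)

/-- `∫₀¹ u ^ n (1 / (u - 1) - 1 / (u log u)) = H_n - γ - log n`, with `n` shifted by one. -/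
lemma integral_pow_mul_gaussKernel (n : ℕ) :
    ∫ u in (0 : ℝ)..1, u ^ n * gaussKernel u =
      harmonic (n + 1) - Real.eulerMascheroniConstant - Real.log (n + 1) := by
  have hint := intervalIntegrable_pow_mul_of_bounded measurable_gaussKernel
    (fun u hu => norm_gaussKernel_le hu)
  set d : ℕ → ℝ := fun n => ∫ u in (0 : ℝ)..1, u ^ n * gaussKernel u with hd
  -- As (u - 1) g(u) = u - (u - 1)/log u, the difference is a power integral minus Frullani's
  -- integral.
  have hstep (n : ℕ) : d (n + 1) - d n =
      1 / (n + 2 : ℝ) - (Real.log (n + 2) - Real.log (n + 1)) := by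
    have h0 : ∫ u in (0 : ℝ)..1, (u ^ (n + 1) - u ^ n) / Real.log u =
        ∫ u in (0 : ℝ)..1, (u ^ (n + 1) - (u ^ (n + 1) * gaussKernel u - u ^ n * gaussKernel u)) := by
      refine intervalIntegral_congr_Ioo fun u hu => ?_
      have hl : Real.log u ≠ 0 := (Real.log_neg hu.1 hu.2).ne
      have : u - 1 ≠ 0 := by linarith [hu.2]
      unfold gaussKernel
      field_simp
      ring
    rw [integral_pow_sub_pow_div_log, intervalIntegral.integral_sub (by simp)
      ((hint _).sub (hint _)), intervalIntegral.integral_sub (hint _) (hint _), integral_pow] at h0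
    rw [h0]
    simp only [hd]
    push_cast
    simp
    ring
  -- Hence d n differs from H_(n+1) - log(n+1) by a constant, which must be -γ because d n tends to
  -- 0.
  have hconst (n : ℕ) : d n - (harmonic (n + 1) - Real.log ((n + 1 : ℕ) : ℝ)) =
      d 0 - (harmonic 1 - Real.log 1) := by
    induction n with
    | zero => simp
    | succ n ih =>
      rw [← ih, harmonic_succ (n + 1)]
      have := hstep n
      push_cast at this ⊢
      rw [show (n + 1 + 1 : ℝ) = n + 2 by ring]
      rw [one_div] at this
      linarith
  have hd0 : Filter.Tendsto d Filter.atTop (nhds 0) := by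
    refine squeeze_zero (fun n => ?_) (fun n => ?_) tendsto_one_div_add_atTop_nhds_zero_nat
    · simp only [hd, intervalIntegral.integral_of_le zero_le_one,
        MeasureTheory.integral_Ioc_eq_integral_Ioo]
      exact MeasureTheory.setIntegral_nonneg measurableSet_Ioo fun u hu =>
        mul_nonneg (pow_nonneg hu.1.le n) (gaussKernel_mem_Icc hu).1
    · have h1 : (1 / (n + 1) : ℝ) = ∫ u in (0 : ℝ)..1, u ^ n := by simp
      rw [h1]
      refine intervalIntegral.integral_mono_on_of_le_Ioo zero_le_one (hint n) (by simp)
        fun u hu => ?_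
      exact mul_le_of_le_one_right (pow_nonneg hu.1.le n) (gaussKernel_mem_Icc hu).2
  have hlim := hd0.sub ((Filter.tendsto_add_atTop_iff_nat 1).2 Real.tendsto_harmonic_sub_log)
  simp_rw [hconst] at hlim
  have h := hconst n
  rw [tendsto_nhds_unique tendsto_const_nhds hlim] at h
  push_cast at h
  change d n = _
  linarith

/-! ### Elementary integrals, digamma and zeta values as real series -/

lemma integral_one_sub_pow_div_one_sub (n : ℕ) :
    ∫ u in (0 : ℝ)..1, (1 - u ^ n) / (1 - 1 * u) = harmonic n := by
  have h : ∫ u in (0 : ℝ)..1, (1 - u ^ n) / (1 - 1 * u) =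
      ∫ u in (0 : ℝ)..1, ∑ i ∈ Finset.range n, u ^ i := by
    refine intervalIntegral_congr_Ioo fun u hu => ?_
    rw [geom_sum_eq hu.2.ne, one_mul, ← neg_sub (u ^ n), ← neg_sub u, neg_div_neg_eq]
  rw [h, intervalIntegral.integral_finsetSum (fun i _ => by simp)]
  simp [harmonic]

lemma integral_one_sub_pow_div_one_add (n : ℕ) :
    ∫ u in (0 : ℝ)..1, (1 - u ^ n) / (1 - -1 * u) =
      Real.log 2 - ∫ u in (0 : ℝ)..1, u ^ n / (1 + u) := by
  have h0 (f : ℝ → ℝ) (hf : Continuous f) :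
      IntervalIntegrable (fun u => f u / (1 + u)) MeasureTheory.volume 0 1 := by
    refine ContinuousOn.intervalIntegrable (hf.continuousOn.div (by fun_prop) fun u hu => ?_)
    rw [Set.uIcc_of_le zero_le_one] at hu
    linarith [hu.1]
  have h1 : ∫ u in (0 : ℝ)..1, 1 / (1 + u) = Real.log 2 := by
    rw [intervalIntegral.integral_comp_add_left (fun u => 1 / u) 1,
      integral_one_div_of_pos (by norm_num) (by norm_num)]
    norm_num
  rw [← h1, ← intervalIntegral.integral_sub (h0 _ (by fun_prop)) (h0 _ (by fun_prop))]
  refine intervalIntegral_congr_Ioo fun u _ => ?_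
  rw [← sub_div]
  ring_nf

lemma digamma_nat_add_one (n : ℕ) :
    Complex.digamma ((n + 1 : ℕ) : ℂ) =
      (((harmonic n : ℝ) - Real.eulerMascheroniConstant : ℝ) : ℂ) := by
  induction n with
  | zero => simp [Complex.digamma_one]
  | succ n ih =>
    have h : ∀ m : ℕ, ((n + 1 : ℕ) : ℂ) ≠ -m := by
      intro m hm
      have h' : ((n + 1 + m : ℕ) : ℂ) = 0 := by
        rw [Nat.cast_add, hm]
        ring
      exact absurd (Nat.cast_eq_zero.1 h') (by omega)
    rw [Nat.cast_succ (n + 1), Complex.digamma_apply_add_one _ h, ih, harmonic_succ]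
    push_cast
    ring

lemma riemannZeta_natCast {r : ℕ} (hr : 2 ≤ r) :
    riemannZeta (r : ℂ) = (twistedZeta 1 r : ℂ) := by
  rw [zeta_eq_tsum_one_div_nat_add_one_cpow (by simpa using (by omega : 1 < r)), twistedZeta, Complex.ofReal_tsum]
  refine tsum_congr fun n => ?_
  rw [Complex.cpow_natCast]
  push_cast
  simp

/-- Linear growth of f costs one power, which is why k ≥ 3 is asked for; it serves for both log n
and H_n. -/
lemma summable_div_succ_pow {f : ℕ → ℝ} {k : ℕ} (hk : 3 ≤ k)
    (hf : ∀ n, ‖f n‖ ≤ ((n + 1 : ℕ) : ℝ)) :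
    Summable fun n : ℕ => f n / ((n + 1 : ℕ) : ℝ) ^ k := by
  refine Summable.of_norm_bounded (summable_one_div_succ_pow (r := k - 1) (by omega)) fun n => ?_
  rw [norm_div, Real.norm_of_nonneg (r := ((n + 1 : ℕ) : ℝ) ^ k) (by positivity),
    div_le_div_iff₀ (by positivity) (by positivity), one_mul]
  calc ‖f n‖ * ((n + 1 : ℕ) : ℝ) ^ (k - 1) ≤ ((n + 1 : ℕ) : ℝ) * ((n + 1 : ℕ) : ℝ) ^ (k - 1) := by
        gcongr
        exact hf n
    _ = ((n + 1 : ℕ) : ℝ) ^ k := by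
        rw [← pow_succ']
        congr 1
        omega

lemma norm_log_succ_le (n : ℕ) : ‖Real.log ((n + 1 : ℕ) : ℝ)‖ ≤ ((n + 1 : ℕ) : ℝ) := by
  rw [Real.norm_of_nonneg (Real.log_natCast_nonneg _)]
  exact Real.log_le_self (by positivity)

lemma norm_harmonic_le (n : ℕ) : ‖(harmonic n : ℝ)‖ ≤ (n : ℝ) := by
  induction n with
  | zero => simp
  | succ n ih =>
    rw [harmonic_succ]
    push_cast
    refine (norm_add_le _ _).trans (add_le_add ih ?_)
    rw [Real.norm_of_nonneg (by positivity)]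
    exact inv_le_one_of_one_le₀ (by simp)

lemma deriv_riemannZeta_natCast {k : ℕ} (hk : 3 ≤ k) :
    deriv riemannZeta (k : ℂ) =
      -((∑' n : ℕ, Real.log ((n + 1 : ℕ) : ℝ) / ((n + 1 : ℕ) : ℝ) ^ k : ℝ) : ℂ) := by
  have hk1 : 1 < (k : ℂ).re := by
    rw [Complex.natCast_re]
    exact_mod_cast (by omega : 1 < k)
  have he : riemannZeta =ᶠ[nhds (k : ℂ)] LSeries 1 := by
    filter_upwards [(isOpen_lt continuous_const Complex.continuous_re).mem_nhds hk1] with s hs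
    exact (LSeries_one_eq_riemannZeta hs).symm
  have hterm (n : ℕ) : LSeries.term (LSeries.logMul 1) k (n + 1) =
      ((Real.log ((n + 1 : ℕ) : ℝ) / ((n + 1 : ℕ) : ℝ) ^ k : ℝ) : ℂ) := by
    rw [LSeries.term_of_ne_zero (Nat.succ_ne_zero n), LSeries.logMul, Complex.cpow_natCast,
      Complex.ofReal_div, Complex.ofReal_log (by positivity)]
    simp
  have hs : Summable (LSeries.term (LSeries.logMul 1) k) := by
    rw [← summable_nat_add_iff 1]
    simp_rw [hterm]
    exact Complex.ofRealCLM.summable (summable_div_succ_pow hk norm_log_succ_le)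
  rw [he.deriv_eq, LSeries_deriv (by rw [LSeries.abscissaOfAbsConv_one]; exact_mod_cast hk1),
    LSeries, hs.tsum_eq_zero_add, LSeries.term_zero, zero_add, Complex.ofReal_tsum]
  simp_rw [hterm]

/-! ### Alternating series -/

lemma tsum_neg_one_pow_mul {f : ℕ → ℝ} (hf : Summable fun n => f (n + 1)) :
    ∑' n : ℕ, (-1) ^ (n + 1) * f (n + 1) =
      2 * ∑' n : ℕ, f (2 * (n + 1)) - ∑' n : ℕ, f (n + 1) := by
  have hinj : Function.Injective fun n : ℕ => 2 * n := fun a b h => by simpa using h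
  have hinj' : Function.Injective fun n : ℕ => 2 * n + 1 := fun a b h => by simpa using h
  have he : Summable fun n => f (2 * n + 1) := hf.comp_injective hinj
  have ho : Summable fun n => f (2 * n + 1 + 1) := hf.comp_injective hinj'
  have h1 := tsum_even_add_odd (f := fun n => f (n + 1)) he ho
  have e1 (n : ℕ) : (-1 : ℝ) ^ (2 * n + 1) * f (2 * n + 1) = -f (2 * n + 1) := by
    rw [pow_succ, pow_mul]; simp
  have e2 (n : ℕ) : (-1 : ℝ) ^ (2 * n + 1 + 1) * f (2 * n + 1 + 1) = f (2 * n + 1 + 1) := by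
    rw [pow_succ, pow_succ, pow_mul]; simp
  have h2 := tsum_even_add_odd (f := fun n => (-1) ^ (n + 1) * f (n + 1))
    (by simp_rw [e1]; exact he.neg) (by simp_rw [e2]; exact ho)
  simp_rw [e1, e2, tsum_neg] at h2
  rw [← h2, ← h1]
  simp_rw [show ∀ n, 2 * (n + 1) = 2 * n + 1 + 1 from fun n => by ring]
  ring

lemma twistedZeta_neg_one {r : ℕ} (hr : 2 ≤ r) :
    twistedZeta (-1) r = (2 / 2 ^ r - 1) * twistedZeta 1 r := by
  have h := tsum_neg_one_pow_mul (f := fun n => 1 / (n : ℝ) ^ r) (summable_one_div_succ_pow hr)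
  have h2 : ∑' n : ℕ, 1 / ((2 * (n + 1) : ℕ) : ℝ) ^ r =
      1 / 2 ^ r * ∑' n : ℕ, 1 / ((n + 1 : ℕ) : ℝ) ^ r := by
    rw [← tsum_mul_left]
    refine tsum_congr fun n => ?_
    push_cast
    rw [mul_pow, one_div_mul_one_div]
  simp only [twistedZeta, one_pow]
  simp_rw [mul_one_div] at h
  rw [h, h2]
  ring

lemma tsum_neg_one_pow_mul_log {k : ℕ} (hk : 3 ≤ k) :
    ∑' n : ℕ, (-1) ^ (n + 1) * (Real.log ((n + 1 : ℕ) : ℝ) / ((n + 1 : ℕ) : ℝ) ^ k) =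
      2 / 2 ^ k * Real.log 2 * twistedZeta 1 k +
        (2 / 2 ^ k - 1) * ∑' n : ℕ, Real.log ((n + 1 : ℕ) : ℝ) / ((n + 1 : ℕ) : ℝ) ^ k := by
  have hs := summable_div_succ_pow hk norm_log_succ_le
  rw [tsum_neg_one_pow_mul (f := fun n => Real.log (n : ℝ) / (n : ℝ) ^ k) hs]
  have h2 : ∑' n : ℕ, Real.log ((2 * (n + 1) : ℕ) : ℝ) / ((2 * (n + 1) : ℕ) : ℝ) ^ k =
      1 / 2 ^ k * Real.log 2 * twistedZeta 1 k +
        1 / 2 ^ k * ∑' n : ℕ, Real.log ((n + 1 : ℕ) : ℝ) / ((n + 1 : ℕ) : ℝ) ^ k := by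
    rw [twistedZeta, ← tsum_mul_left, ← tsum_mul_left, ← Summable.tsum_add
      ((summable_twistedZeta (by simp) (by omega)).mul_left _) (hs.mul_left _)]
    refine tsum_congr fun n => ?_
    rw [Nat.cast_mul, Real.log_mul (by simp) (by positivity), mul_pow]
    push_cast
    field_simp
    simp
  rw [h2]
  ring

lemma tsum_harmonic_div_pow {k : ℕ} (hk : 3 ≤ k) :
    ∑' n : ℕ, (harmonic (n + 1) : ℝ) / ((n + 1 : ℕ) : ℝ) ^ k = tornheim 1 1 (k - 1) := by
  rw [tornheim_one_eq_tsum (by simp) (by omega)]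
  refine tsum_congr fun n => ?_
  rw [integral_one_sub_pow_div_one_sub, Nat.sub_add_cancel (by omega)]
  simp

/-- Uses H_(2n-1) = H_(2n) - 1/(2n) and n^k = (2n)^k/2^k, to express the real form of F_k(2) through
the even part of ∑ H_n/n^k. -/
lemma tsum_harmonic_two_mul {k : ℕ} (hk : 3 ≤ k) :
    (Summable fun n : ℕ => ((harmonic (2 * n + 1) : ℝ) - Real.eulerMascheroniConstant) /
      ((n + 1 : ℕ) : ℝ) ^ k) ∧
    ∑' n : ℕ, ((harmonic (2 * n + 1) : ℝ) - Real.eulerMascheroniConstant) /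
        ((n + 1 : ℕ) : ℝ) ^ k =
      2 ^ k * ∑' n : ℕ, (harmonic (2 * (n + 1)) : ℝ) / ((2 * (n + 1) : ℕ) : ℝ) ^ k -
        twistedZeta 1 (k + 1) / 2 - Real.eulerMascheroniConstant * twistedZeta 1 k := by
  have hs : Summable fun n : ℕ => (harmonic (2 * (n + 1)) : ℝ) / ((2 * (n + 1) : ℕ) : ℝ) ^ k := by
    have h := summable_div_succ_pow (f := fun n => (harmonic (n + 1) : ℝ)) hk
      fun n => norm_harmonic_le _
    exact h.comp_injective (i := fun n : ℕ => 2 * n + 1) fun a b h => by simpa using h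
  have h1 := summable_twistedZeta (e := 1) (by simp) (r := k + 1) (by omega)
  have h2 := summable_twistedZeta (e := 1) (by simp) (r := k) (by omega)
  have hterm (n : ℕ) : ((harmonic (2 * n + 1) : ℝ) - Real.eulerMascheroniConstant) /
      ((n + 1 : ℕ) : ℝ) ^ k =
      2 ^ k * ((harmonic (2 * (n + 1)) : ℝ) / ((2 * (n + 1) : ℕ) : ℝ) ^ k) -
        1 ^ (n + 1) / ((n + 1 : ℕ) : ℝ) ^ (k + 1) / 2 -
        Real.eulerMascheroniConstant * (1 ^ (n + 1) / ((n + 1 : ℕ) : ℝ) ^ k) := by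
    rw [show 2 * (n + 1) = 2 * n + 1 + 1 by ring, harmonic_succ (2 * n + 1)]
    push_cast
    rw [show (2 * n + 1 + 1 : ℝ) = 2 * (n + 1) by ring, mul_pow]
    have : (n + 1 : ℝ) ≠ 0 := by positivity
    field_simp
    ring
  simp_rw [hterm, twistedZeta]
  refine ⟨((hs.mul_left _).sub (h1.div_const 2)).sub (h2.mul_left _), ?_⟩
  rw [Summable.tsum_sub ((hs.mul_left _).sub (h1.div_const 2)) (h2.mul_left _),
    Summable.tsum_sub (hs.mul_left _) (h1.div_const 2), tsum_mul_left, tsum_mul_left,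
    tsum_div_const]

lemma summable_bounded_div_succ_pow {f : ℕ → ℝ} {C : ℝ} (hf : ∀ n, ‖f n‖ ≤ C) {k : ℕ} (hk : 2 ≤ k) :
    Summable fun n : ℕ => f n / ((n + 1 : ℕ) : ℝ) ^ k := by
  simpa only [mul_one_div] using
    summable_mul_of_bounded C hf (summable_one_div_succ_pow hk) (fun n => by positivity)

lemma norm_integral_pow_div_one_add_le (n : ℕ) :
    ‖∫ u in (0 : ℝ)..1, u ^ n / (1 + u)‖ ≤ 1 := by
  have h := intervalIntegral.norm_integral_le_of_norm_le_const (a := 0) (b := 1) (C := 1)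
    (f := fun u : ℝ => u ^ n / (1 + u)) fun u hu => ?_
  · simpa using h
  · rw [Set.uIoc_of_le zero_le_one] at hu
    have h0 := hu.1
    rw [Real.norm_of_nonneg (by positivity)]
    exact div_le_one_of_le₀ ((pow_le_one₀ hu.1.le hu.2).trans (by linarith)) (by linarith)

lemma tsum_neg_one_pow_mul_integral {k : ℕ} (hk : 3 ≤ k) :
    ∑' n : ℕ, (-1) ^ (n + 1) * (∫ u in (0 : ℝ)..1, u ^ (n + 1) / (1 + u)) /
        ((n + 1 : ℕ) : ℝ) ^ k =
      tornheim (-1) 1 (k - 1) + Real.log 2 * twistedZeta (-1) k := by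
  rw [tornheim_one_eq_tsum (by simp) (by omega), twistedZeta, ← tsum_mul_left,
    ← Summable.tsum_add]
  · refine tsum_congr fun n => ?_
    rw [integral_one_sub_pow_div_one_add, Nat.sub_add_cancel (by omega)]
    ring
  · rw [Nat.sub_add_cancel (by omega)]
    refine summable_bounded_div_succ_pow (C := Real.log 2 + 1) (fun n => ?_) (by omega)
    rw [integral_one_sub_pow_div_one_add, norm_mul, norm_mul, norm_pow]
    simp only [norm_neg, norm_one, one_pow, one_mul]
    refine (norm_sub_le _ _).trans (add_le_add ?_ (norm_integral_pow_div_one_add_le _))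
    rw [Real.norm_of_nonneg (Real.log_nonneg (by norm_num))]
  · exact (summable_twistedZeta (by simp) (by omega)).mul_left _

/-- The factors multiply to 1 + 2/2^k - 2^r/2^k - 2/2^r. As k + 1 is even, r ↦ k + 1 - r preserves
the sign (-1)^r and turns the last term into the third. -/
lemma sum_twistedZeta_neg_one {k : ℕ} (hodd : Odd k) :
    ∑ r ∈ Finset.Icc 2 (k - 1),
        (-1 : ℝ) ^ r * twistedZeta (-1) r * twistedZeta (-1) (k + 1 - r) =
      ∑ r ∈ Finset.Icc 2 (k - 1), (-1 : ℝ) ^ r * (1 + 2 / 2 ^ k - 2 * 2 ^ r / 2 ^ k) *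
        twistedZeta 1 r * twistedZeta 1 (k + 1 - r) := by
  have hrefl : ∑ r ∈ Finset.Icc 2 (k - 1),
        (-1 : ℝ) ^ r * (2 / 2 ^ r) * twistedZeta 1 r * twistedZeta 1 (k + 1 - r) =
      ∑ r ∈ Finset.Icc 2 (k - 1),
        (-1 : ℝ) ^ r * (2 ^ r / 2 ^ k) * twistedZeta 1 r * twistedZeta 1 (k + 1 - r) := by
    refine Finset.sum_nbij' (fun r => k + 1 - r) (fun r => k + 1 - r) ?_ ?_ ?_ ?_ ?_
    · simp only [Finset.mem_Icc]; omega
    · simp only [Finset.mem_Icc]; omega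
    · simp only [Finset.mem_Icc]; omega
    · simp only [Finset.mem_Icc]; omega
    · intro r hr
      rw [Finset.mem_Icc] at hr
      rw [show k + 1 - (k + 1 - r) = r by omega]
      have h1 : (-1 : ℝ) ^ (k + 1 - r) = (-1) ^ r := by
        have : (-1 : ℝ) ^ (k + 1 - r) * (-1) ^ r = 1 := by
          rw [← pow_add, Nat.sub_add_cancel (by omega)]
          exact (hodd.add_odd odd_one).neg_one_pow
        rcases neg_one_pow_eq_or ℝ r with h | h <;> rw [h] at this ⊢ <;> linarith
      have h2 : (2 : ℝ) ^ (k + 1 - r) / 2 ^ k = 2 / 2 ^ r := by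
        rw [div_eq_div_iff (by positivity) (by positivity), ← pow_add,
          Nat.sub_add_cancel (by omega), pow_succ']
      rw [h1, h2]
      ring
  have hterm : ∀ r ∈ Finset.Icc 2 (k - 1),
      (-1 : ℝ) ^ r * twistedZeta (-1) r * twistedZeta (-1) (k + 1 - r) =
      (-1 : ℝ) ^ r * (1 + 2 / 2 ^ k - 2 ^ r / 2 ^ k) * twistedZeta 1 r * twistedZeta 1 (k + 1 - r)
      - (-1 : ℝ) ^ r * (2 / 2 ^ r) * twistedZeta 1 r * twistedZeta 1 (k + 1 - r) := by
    intro r hr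
    rw [Finset.mem_Icc] at hr
    rw [twistedZeta_neg_one hr.1, twistedZeta_neg_one (r := k + 1 - r) (by omega)]
    have h2 : (2 : ℝ) / 2 ^ (k + 1 - r) = 2 ^ r / 2 ^ k := by
      rw [div_eq_div_iff (by positivity) (by positivity), ← pow_add,
        Nat.add_sub_cancel' (by omega), pow_succ']
    rw [h2]
    have h3 : (2 : ℝ) / 2 ^ r * (2 ^ r / 2 ^ k) = 2 / 2 ^ k := by field_simp
    linear_combination ((-1 : ℝ) ^ r * twistedZeta 1 r * twistedZeta 1 (k + 1 - r)) * h3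
  rw [Finset.sum_congr rfl hterm, Finset.sum_sub_distrib, hrefl, ← Finset.sum_sub_distrib]
  exact Finset.sum_congr rfl fun r _ => by ring

lemma tsum_neg_one_pow_mul_harmonic_sub_log {k : ℕ} (hk : 3 ≤ k) :
    (Summable fun n : ℕ => (-1 : ℝ) ^ (n + 1) *
      (((harmonic (n + 1) : ℝ) - Real.eulerMascheroniConstant - Real.log ((n + 1 : ℕ) : ℝ)) /
        ((n + 1 : ℕ) : ℝ) ^ k)) ∧
    ∑' n : ℕ, (-1 : ℝ) ^ (n + 1) *
      (((harmonic (n + 1) : ℝ) - Real.eulerMascheroniConstant - Real.log ((n + 1 : ℕ) : ℝ)) /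
        ((n + 1 : ℕ) : ℝ) ^ k) =
      2 * ∑' n : ℕ, (harmonic (2 * (n + 1)) : ℝ) / ((2 * (n + 1) : ℕ) : ℝ) ^ k -
        tornheim 1 1 (k - 1) - Real.eulerMascheroniConstant * twistedZeta (-1) k -
        (2 / 2 ^ k * Real.log 2 * twistedZeta 1 k +
        (2 / 2 ^ k - 1) * ∑' n : ℕ, Real.log ((n + 1 : ℕ) : ℝ) / ((n + 1 : ℕ) : ℝ) ^ k) := by
  have hneg {f : ℕ → ℝ} (hf : Summable f) : Summable fun n => (-1 : ℝ) ^ (n + 1) * f n := by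
    refine Summable.of_norm_bounded hf.norm fun n => ?_
    rw [norm_mul, norm_pow, norm_neg, norm_one, one_pow, one_mul]
  have hH : Summable fun n : ℕ => (harmonic (n + 1) : ℝ) / ((n + 1 : ℕ) : ℝ) ^ k :=
    summable_div_succ_pow hk fun n => norm_harmonic_le _
  have h1 := hneg hH
  have h2 := (summable_twistedZeta (e := -1) (by simp) (r := k) (by omega)).mul_left
    Real.eulerMascheroniConstant
  have h3 := hneg (summable_div_succ_pow hk norm_log_succ_le)
  have hterm (n : ℕ) : (-1 : ℝ) ^ (n + 1) *
      (((harmonic (n + 1) : ℝ) - Real.eulerMascheroniConstant - Real.log ((n + 1 : ℕ) : ℝ)) /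
        ((n + 1 : ℕ) : ℝ) ^ k) = (-1) ^ (n + 1) * ((harmonic (n + 1) : ℝ) / ((n + 1 : ℕ) : ℝ) ^ k) -
        Real.eulerMascheroniConstant * ((-1) ^ (n + 1) / ((n + 1 : ℕ) : ℝ) ^ k) -
        (-1) ^ (n + 1) * (Real.log ((n + 1 : ℕ) : ℝ) / ((n + 1 : ℕ) : ℝ) ^ k) := by
    ring
  simp_rw [hterm]
  refine ⟨(h1.sub h2).sub h3, ?_⟩
  rw [(h1.sub h2).tsum_sub h3, h1.tsum_sub h2, tsum_mul_left, tsum_neg_one_pow_mul_log hk,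
    tsum_neg_one_pow_mul (f := fun n => (harmonic n : ℝ) / (n : ℝ) ^ k) hH,
    tsum_harmonic_div_pow hk]
  rfl

/-! ### Reduction of the integral to series -/

/-- The real-valued form of `polylogIntegrand`. -/
noncomputable def realPolylogIntegrand (k : ℕ) (u : ℝ) : ℝ :=
  (2 ^ (k - 1) / (u - 1) - 2 * u / (u ^ 2 - 1) - (2 ^ (k - 1) - 1) / (u * Real.log u)) *
    ∑' n : ℕ, (-u) ^ (n + 1) / ((n + 1 : ℕ) : ℝ) ^ k

lemma two_zpow_natCast_sub_one (k : ℕ) (hk : 1 ≤ k) : (2 : ℂ) ^ ((k : ℤ) - 1) = 2 ^ (k - 1) := by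
  rw [← zpow_natCast]
  congr 1
  omega

lemma polylogIntegrand_eq_ofReal {k : ℕ} (hk : 1 ≤ k) (u : ℝ) :
    polylogIntegrand k u = (realPolylogIntegrand k u : ℂ) := by
  rw [polylogIntegrand, realPolylogIntegrand, polylog, two_zpow_natCast_sub_one k hk, Complex.ofReal_mul,
    Complex.ofReal_tsum]
  congr 1
  · push_cast
    rfl
  · refine tsum_congr fun n => ?_
    rw [Complex.cpow_natCast]
    push_cast
    rfl

lemma realPolylogIntegrand_eq_tsum {k : ℕ} {u : ℝ} (hu : u ∈ Set.Ioo (0 : ℝ) 1) :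
    realPolylogIntegrand k u = ∑' n : ℕ, (-1) ^ (n + 1) / ((n + 1 : ℕ) : ℝ) ^ k *
      (u ^ n * ((2 ^ (k - 1) - 1) * gaussKernel u - u / (1 + u))) := by
  rw [realPolylogIntegrand, ← tsum_mul_left]
  refine tsum_congr fun n => ?_
  have h1 : Real.log u ≠ 0 := (Real.log_neg hu.1 hu.2).ne
  have h2 : u - 1 ≠ 0 := by linarith [hu.2]
  have h3 : u ≠ 0 := hu.1.ne'
  have h4 : 1 + u ≠ 0 := by linarith [hu.1]
  have h5 : u ^ 2 - 1 = (u - 1) * (1 + u) := by ring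
  -- The 1/u is absorbed by the polylogarithm, whose powers then start at u^0.
  have key : (2 : ℝ) ^ (k - 1) / (u - 1) - 2 * u / (u ^ 2 - 1) -
      (2 ^ (k - 1) - 1) / (u * Real.log u) =
      ((2 ^ (k - 1) - 1) * gaussKernel u - u / (1 + u)) / u := by
    rw [h5, gaussKernel]
    field_simp
    ring
  rw [key, neg_pow u]
  field_simp
  ring

lemma integral_realPolylogIntegrand {k : ℕ} (hk : 3 ≤ k) :
    IntervalIntegrable (realPolylogIntegrand k) MeasureTheory.volume 0 1 ∧
    ∫ u in (0 : ℝ)..1, realPolylogIntegrand k u =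
      (2 ^ (k - 1) - 1) * (∑' n : ℕ, (-1 : ℝ) ^ (n + 1) *
        (((harmonic (n + 1) : ℝ) - Real.eulerMascheroniConstant - Real.log ((n + 1 : ℕ) : ℝ)) /
        ((n + 1 : ℕ) : ℝ) ^ k)) -
      ∑' n : ℕ, (-1) ^ (n + 1) * (∫ u in (0 : ℝ)..1, u ^ (n + 1) / (1 + u)) /
        ((n + 1 : ℕ) : ℝ) ^ k := by
  set A : ℝ := 2 ^ (k - 1) - 1 with hA
  have hc : Summable fun n : ℕ => ‖(-1 : ℝ) ^ (n + 1) / ((n + 1 : ℕ) : ℝ) ^ k‖ :=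
    (summable_twistedZeta (by simp) (by omega)).norm
  have hm2 : Measurable fun u : ℝ => u / (1 + u) := by fun_prop
  have hb2 : ∀ u ∈ Set.Ioo (0 : ℝ) 1, ‖u / (1 + u)‖ ≤ 1 := by
    intro u hu
    have h0 := hu.1
    rw [Real.norm_of_nonneg (by positivity)]
    exact div_le_one_of_le₀ (by linarith) (by linarith)
  have hm : Measurable fun u => A * gaussKernel u - u / (1 + u) :=
    (measurable_gaussKernel.const_mul A).sub hm2
  have hb : ∀ u ∈ Set.Ioo (0 : ℝ) 1, ‖A * gaussKernel u - u / (1 + u)‖ ≤ ‖A‖ * 1 + 1 := by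
    intro u hu
    refine (norm_sub_le _ _).trans (add_le_add ?_ (hb2 u hu))
    rw [norm_mul]
    exact mul_le_mul_of_nonneg_left (norm_gaussKernel_le hu) (norm_nonneg _)
  obtain ⟨hI, hS⟩ := integrable_and_hasSum_integral_tsum_mul hc hm hb
  constructor
  · rw [intervalIntegrable_iff_integrableOn_Ioo_of_le zero_le_one] at hI ⊢
    exact hI.congr_fun (fun u hu => (realPolylogIntegrand_eq_tsum hu).symm) measurableSet_Ioo
  · rw [intervalIntegral_congr_Ioo fun u hu => realPolylogIntegrand_eq_tsum hu, ← hS.tsum_eq,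
      ← tsum_mul_left, ← Summable.tsum_sub]
    · refine tsum_congr fun n => ?_
      have h1 : ∫ u in (0 : ℝ)..1, u ^ n * (A * gaussKernel u - u / (1 + u)) =
          A * (∫ u in (0 : ℝ)..1, u ^ n * gaussKernel u) -
            ∫ u in (0 : ℝ)..1, u ^ (n + 1) / (1 + u) := by
        have hi1 := intervalIntegrable_pow_mul_of_bounded measurable_gaussKernel
          (fun u hu => norm_gaussKernel_le hu) n
        have hi2 := intervalIntegrable_pow_mul_of_bounded hm2 hb2 n
        have e2 : ∫ u in (0 : ℝ)..1, u ^ (n + 1) / (1 + u) =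
            ∫ u in (0 : ℝ)..1, u ^ n * (u / (1 + u)) := by
          congr 1
          ext u
          ring
        rw [e2, ← intervalIntegral.integral_const_mul,
          ← intervalIntegral.integral_sub (hi1.const_mul A) hi2]
        congr 1
        ext u
        ring
      rw [h1, integral_pow_mul_gaussKernel]
      push_cast
      ring
    · exact (tsum_neg_one_pow_mul_harmonic_sub_log hk).1.mul_left A
    · refine summable_bounded_div_succ_pow (C := 1) (fun n => ?_) (by omega)
      rw [norm_mul, norm_pow, norm_neg, norm_one, one_pow, one_mul]
      exact norm_integral_pow_div_one_add_le _

/-! ### Assembly -/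

lemma higherHerglotzTerm_two (k n : ℕ) :
    higherHerglotzTerm k 2 n =
      ((((harmonic (2 * n + 1) : ℝ) - Real.eulerMascheroniConstant) /
        ((n + 1 : ℕ) : ℝ) ^ k : ℝ) : ℂ) := by
  rw [higherHerglotzTerm,
    show ((n + 1 : ℕ) : ℂ) * 2 = ((2 * n + 1 + 1 : ℕ) : ℂ) by push_cast; ring,
    digamma_nat_add_one, Complex.ofReal_div]
  push_cast
  rfl

lemma integral_realPolylogIntegrand_eq {k : ℕ} (hk : 3 ≤ k) (hodd : Odd k) :
    ∫ u in (0 : ℝ)..1, realPolylogIntegrand k u =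
      (1 - 2 / 2 ^ k) * (∑' n : ℕ, ((harmonic (2 * n + 1) : ℝ) - Real.eulerMascheroniConstant) /
        ((n + 1 : ℕ) : ℝ) ^ k)
      + (2 ^ k / 2 - 1) * Real.eulerMascheroniConstant * twistedZeta 1 k
      + (1 / 2 - 1 / 2 ^ k) * twistedZeta 1 (k + 1)
      + (2 - 2 ^ k / 2 - 2 / 2 ^ k) *
        -(∑' n : ℕ, Real.log ((n + 1 : ℕ) : ℝ) / ((n + 1 : ℕ) : ℝ) ^ k)
      + ∑ r ∈ Finset.Icc 2 (k - 1), (-1) ^ (r - 1) * (2 ^ k / 4 + 1 / 2 ^ k - 2 ^ r / 2 ^ k) *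
        twistedZeta 1 r * twistedZeta 1 (k + 1 - r) := by
  have hT := tornheim_one_of_odd (e := -1) (by simp) (by omega) hodd
  have hh := tornheim_one_of_odd (e := 1) (by simp) (by omega) hodd
  rw [sum_twistedZeta_neg_one hodd] at hT
  have hsum : ∑ r ∈ Finset.Icc 2 (k - 1), (-1 : ℝ) ^ (r - 1) *
        (2 ^ k / 4 + 1 / 2 ^ k - 2 ^ r / 2 ^ k) * twistedZeta 1 r * twistedZeta 1 (k + 1 - r) =
      -- The coefficient 2^k/4 - 1/2 is half of 2^(k-1) - 1.
      -(2 ^ k / 4 - 1 / 2) * (2 * tornheim 1 1 (k - 1)) - tornheim (-1) 1 (k - 1) := by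
    have e : tornheim (-1) 1 (k - 1) = 1 / 2 * (2 * tornheim (-1) 1 (k - 1)) := by ring
    rw [e, hh, hT, Finset.mul_sum, Finset.mul_sum, ← Finset.sum_sub_distrib]
    refine Finset.sum_congr rfl fun r hr => ?_
    rw [Finset.mem_Icc] at hr
    obtain ⟨r, rfl⟩ : ∃ s, r = s + 1 := ⟨r - 1, by omega⟩
    rw [Nat.add_sub_cancel, pow_succ (-1 : ℝ) r]
    ring
  rw [(integral_realPolylogIntegrand hk).2, (tsum_neg_one_pow_mul_harmonic_sub_log hk).2,
    tsum_neg_one_pow_mul_integral hk, (tsum_harmonic_two_mul hk).2, hsum,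
    twistedZeta_neg_one (r := k) (by omega)]
  have hq : (2 : ℝ) ^ (k - 1) = 2 ^ k / 2 := by
    obtain ⟨j, rfl⟩ : ∃ j, k = j + 1 := ⟨k - 1, by omega⟩
    rw [Nat.add_sub_cancel, pow_succ]
    ring
  rw [hq]
  have hq0 : (2 : ℝ) ^ k ≠ 0 := by positivity
  -- What remains is an identity rational in q = 2^k, in which the log 2 terms cancel.
  generalize (2 : ℝ) ^ k = q at *
  field_simp
  ring

/-- The integral of the polylogarithm over `[0, 1]` in terms of `F_k(2)`, for odd `k > 1`,
together with the convergence of the integral and of the series defining `F_k(2)`. -/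
theorem corollary2p10 (k : ℕ) (hk : 1 < k) (hodd : Odd k) :
    Summable (higherHerglotzTerm k 2) ∧
    IntervalIntegrable (polylogIntegrand k) MeasureTheory.volume 0 1 ∧
    (∫ u in (0 : ℝ)..1, polylogIntegrand k u) =
      (1 - (2 : ℂ) ^ (1 - (k : ℤ))) * higherHerglotz k 2
      + ((2 : ℂ) ^ ((k : ℤ) - 1) - 1) * (Real.eulerMascheroniConstant : ℂ) * riemannZeta (k : ℂ)
      + (1 / 2 - (2 : ℂ) ^ (-(k : ℤ))) * riemannZeta ((k : ℂ) + 1)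
      + (2 - (2 : ℂ) ^ ((k : ℤ) - 1) - (2 : ℂ) ^ (1 - (k : ℤ))) * deriv riemannZeta (k : ℂ)
      + ∑ r ∈ Finset.Icc 2 (k - 1), (-1 : ℂ) ^ (r - 1)
          * ((2 : ℂ) ^ ((k : ℤ) - 2) + (2 : ℂ) ^ (-(k : ℤ)) - (2 : ℂ) ^ ((r : ℤ) - (k : ℤ)))
          * riemannZeta (r : ℂ) * riemannZeta ((k : ℂ) + 1 - (r : ℂ)) := by
  have hk3 : 3 ≤ k := by
    obtain ⟨m, rfl⟩ := hodd
    omega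
  have hF : higherHerglotzTerm k 2 = fun n => _ := funext (higherHerglotzTerm_two k)
  have hP : polylogIntegrand k = fun u => _ :=
    funext (polylogIntegrand_eq_ofReal (k := k) (by omega))
  have h2 : (2 : ℂ) ≠ 0 := two_ne_zero
  refine ⟨?_, ?_, ?_⟩
  · rw [hF]
    exact Complex.ofRealCLM.summable (tsum_harmonic_two_mul hk3).1
  · rw [hP]
    obtain ⟨h, h'⟩ := (integral_realPolylogIntegrand hk3).1
    exact ⟨h.ofReal, h'.ofReal⟩
  · rw [hP, intervalIntegral.integral_ofReal, integral_realPolylogIntegrand_eq hk3 hodd,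
      higherHerglotz, hF, ← Complex.ofReal_tsum, deriv_riemannZeta_natCast hk3,
      riemannZeta_natCast (r := k) (by omega), ← Nat.cast_succ,
      riemannZeta_natCast (r := k + 1) (by omega), zpow_sub₀ h2, zpow_sub₀ h2, zpow_sub₀ h2,
      zpow_neg]
    simp only [zpow_natCast, zpow_one]
    have hsum : ∑ r ∈ Finset.Icc 2 (k - 1), (-1 : ℂ) ^ (r - 1)
          * ((2 : ℂ) ^ k / 2 ^ (2 : ℤ) + ((2 : ℂ) ^ k)⁻¹ - (2 : ℂ) ^ ((r : ℤ) - (k : ℤ)))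
          * riemannZeta (r : ℂ) * riemannZeta (((k + 1 : ℕ) : ℂ) - (r : ℂ)) =
        ((∑ r ∈ Finset.Icc 2 (k - 1), (-1) ^ (r - 1) * (2 ^ k / 4 + 1 / 2 ^ k - 2 ^ r / 2 ^ k) *
        twistedZeta 1 r * twistedZeta 1 (k + 1 - r) : ℝ) : ℂ) := by
      rw [Complex.ofReal_sum]
      refine Finset.sum_congr rfl fun r hr => ?_
      rw [Finset.mem_Icc] at hr
      rw [← Nat.cast_sub (show r ≤ k + 1 by omega), riemannZeta_natCast hr.1,
        riemannZeta_natCast (r := k + 1 - r) (by omega), zpow_sub₀ h2, zpow_natCast, zpow_natCast]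
      push_cast
      norm_num
    rw [hsum]
    push_cast
    simp only [one_div]
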